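/- For finite simple graphs $G$ and $H$ and a map $f\colon E(H)\to E(H)$, a copy of $G$ in $H$ (a not necessarily induced subgraph $G'$ of $H$ isomorphic to $G$) is called $f$-free if $f(e)\notin E(G')$ for every $e\in E(G')$. Let $h(n,G)$ denote the maximum number of edges of a graph $H$ on $n$ vertices for which there is a map $f\colon E(H)\to E(H)$ with $f(e)\neq e$ for all $e\in E(H)$ such that $H$ contains no $f$-free copy of $G$. Let $\mathrm{ex}(n,G)$ denote the maximum number of edges of an $n$-vertex graph that does not contain $G$ as a subgraph, and let $tK_2$ be the graph consisting of $t$ pairwise vertex-disjoint edges. (1) $h(n,2K_2)=n$ for all $n\ge 7$, and $h(4,2K_2)=6$, $h(5,2K_2)=h(6,2K_2)=7$. (2) For every $t\ge 3$ there exists $n_t$ such that for all $n\ge n_t$, $$h(n,tK_2)=\mathrm{ex}(n,tK_2)+t-1=(t-1)(n-t+1)+\binom{t-1}{2}+(t-1).$$ -/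

import Mathlib

namespace EdgeMapping

/-- `copies k G` is `kG`, the vertex-disjoint union of `k` copies of `G`. -/
def copies {W : Type*} (k : ℕ) (G : SimpleGraph W) : SimpleGraph (Fin k × W) where
  Adj x y := x.1 = y.1 ∧ G.Adj x.2 y.2
  symm := ⟨fun _ _ h => ⟨h.1.symm, h.2.symm⟩⟩
  loopless := ⟨fun _ h => h.2.ne rfl⟩

/-- `matching t` is `tK₂`, the graph consisting of `t` disjoint edges. -/
abbrev matching (t : ℕ) : SimpleGraph (Fin t × Fin 2) :=
  copies t (SimpleGraph.completeGraph (Fin 2))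

/-- A copy `φ` of `G` in `H` is `f`-free if no edge of the copy is mapped by `f` to an edge of
the copy. -/
def IsFreeCopy {V W : Type*} {G : SimpleGraph W} {H : SimpleGraph V}
    (f : H.edgeSet → H.edgeSet) (φ : G.Copy H) : Prop :=
  ∀ e : G.edgeSet, f (φ.mapEdgeSet e) ∉ Set.range φ.mapEdgeSet

/-- There is a fixed-point-free map `f : E(H) → E(H)` such that `H` has no `f`-free copy of `G`. -/
def Avoids {V W : Type*} (G : SimpleGraph W) (H : SimpleGraph V) : Prop :=
  ∃ f : H.edgeSet → H.edgeSet, (∀ e, f e ≠ e) ∧ ∀ φ : G.Copy H, ¬ IsFreeCopy f φ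

/-- The numbers of edges of the `n`-vertex graphs `H` that admit a fixed-point-free map
`f : E(H) → E(H)` with no `f`-free copy of `G`. -/
def hSet {W : Type*} (n : ℕ) (G : SimpleGraph W) : Set ℕ :=
  {m | ∃ H : SimpleGraph (Fin n), H.edgeSet.ncard = m ∧ Avoids G H}

/-- `h(n, G)`, the maximum of `hSet n G`. -/
noncomputable def h {W : Type*} (n : ℕ) (G : SimpleGraph W) : ℕ :=
  sSup (hSet n G)

theorem finite_hSet {W : Type*} (n : ℕ) (G : SimpleGraph W) : (hSet n G).Finite :=
  (Set.finite_range fun H : SimpleGraph (Fin n) => H.edgeSet.ncard).subset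
    fun _ ⟨H, hm, _⟩ => ⟨H, hm⟩

theorem zero_mem_hSet {W : Type*} (n : ℕ) {G : SimpleGraph W} (hG : G ≠ ⊥) :
    0 ∈ hSet n G := by
  have : IsEmpty (⊥ : SimpleGraph (Fin n)).edgeSet := by simp
  refine ⟨⊥, by simp, isEmptyElim, isEmptyElim, fun φ => ?_⟩
  exact absurd ⟨φ⟩ (SimpleGraph.free_bot hG)

/-- The supremum defining `h(n, G)` is an attained maximum whenever `G` has an edge. -/
theorem isGreatest_h {W : Type*} (n : ℕ) {G : SimpleGraph W} (hG : G ≠ ⊥) :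
    IsGreatest (hSet n G) (h n G) :=
  ⟨Nat.sSup_mem ⟨0, zero_mem_hSet n hG⟩ (finite_hSet n G).bddAbove,
    fun _ hm => le_csSup (finite_hSet n G).bddAbove hm⟩

end EdgeMapping

/-! A copy of `tK₂` is a set of `t` disjoint edges, so `Avoids` asks that every `t`-matching contain
some `e` together with `f e`.

For large `n`, split by the vertices of large degree. If there are `t` of them, a counting argument
(`exists_transversal`) picks disjoint edges from their stars with no edge mapped to another. If
there are at most `t - 2`, many edges of a bounded-degree graph remain, hence a huge matching with
an `f`-free submatching. With exactly `t - 1`, the edges meeting this set `A` number at most the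
extremal value, so `t` excess edges miss `A`. Each vertex of `A` can have more than half of its
edges mapped to at most one of them, so some excess edge `e` is usable at every vertex of `A`
(`exists_edge_of_card_lt`) and completes a free matching. The extremal number follows from the same
trichotomy, where one excess edge suffices. Equality: join `t - 1` vertices to everything and add a
star with `t - 1` edges outside (`mem_hSet_matching`).

For `t = 2` and small `n`, one of any two disjoint edges is mapped to the other, so the number of
disjoint pairs is at most the number of edges. Counting pairs, against a star at a vertex of maximum
degree unless all degrees are at most 3, gives the bound `max n 7`. -/

namespace EdgeMapping

open Finset

/-- A finite set of edges is a matching if distinct members share no vertex. -/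
def IsMatching {V : Type*} (M : Finset (Sym2 V)) : Prop :=
  ∀ e ∈ M, ∀ e' ∈ M, ∀ v, v ∈ e → v ∈ e' → e = e'

/-! ### Copies of `tK₂` as matchings -/

section Copies

variable {V : Type*} {H : SimpleGraph V} {t : ℕ}

theorem matching_adj (i : Fin t) : (matching t).Adj (i, 0) (i, 1) :=
  ⟨rfl, by simp⟩

theorem exists_eq_of_mem_edgeSet_matching {e : Sym2 (Fin t × Fin 2)}
    (he : e ∈ (matching t).edgeSet) : ∃ i : Fin t, e = s((i, 0), (i, 1)) := by
  induction e with
  | _ x y =>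
    obtain ⟨i, a⟩ := x
    obtain ⟨j, b⟩ := y
    obtain ⟨h1, h2⟩ := (SimpleGraph.mem_edgeSet _).1 he
    simp only at h1 h2
    subst h1
    have h3 : a ≠ b := h2.ne
    refine ⟨i, ?_⟩
    fin_cases a <;> fin_cases b <;> simp_all [Sym2.eq_swap]

/-- The edges of a copy of `tK₂` form a matching of size `t`. -/
theorem exists_isMatching_of_copy (φ : (matching t).Copy H) :
    ∃ M : Finset (Sym2 V), (∀ e, e ∈ M ↔ ∃ x, (φ.mapEdgeSet x : Sym2 V) = e) ∧
      IsMatching M ∧ #M = t := by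
  classical
  have hinj : Function.Injective φ := φ.injective
  have key : ∀ i j : Fin t, ∀ v, v ∈ s(φ (i, 0), φ (i, 1)) → v ∈ s(φ (j, 0), φ (j, 1)) →
      i = j := by
    intro i j v hi hj
    rw [Sym2.mem_iff] at hi hj
    rcases hi with rfl | rfl <;> rcases hj with h | h <;>
      exact congrArg Prod.fst (hinj h)
  refine ⟨univ.image fun i : Fin t => s(φ (i, 0), φ (i, 1)), ?_, ?_, ?_⟩
  · intro e
    simp only [mem_image, mem_univ, true_and]
    constructor
    · rintro ⟨i, rfl⟩
      exact ⟨⟨s((i, 0), (i, 1)), matching_adj i⟩, rfl⟩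
    · rintro ⟨⟨x, hx⟩, rfl⟩
      obtain ⟨i, rfl⟩ := exists_eq_of_mem_edgeSet_matching hx
      exact ⟨i, rfl⟩
  · intro e he e' he' v hv hv'
    simp only [mem_image, mem_univ, true_and] at he he'
    obtain ⟨i, rfl⟩ := he
    obtain ⟨j, rfl⟩ := he'
    rw [key i j v hv hv']
  · rw [card_image_of_injective, card_univ, Fintype.card_fin]
    intro i j hij
    simp only at hij
    exact key i j (φ (i, 0)) (by simp) (by rw [← hij]; simp)

/-- A matching of size `t` in `H` is the edge set of a copy of `tK₂`. -/
theorem IsMatching.exists_copy {M : Finset (Sym2 V)} (hM : IsMatching M)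
    (hMH : ∀ e ∈ M, e ∈ H.edgeSet) (hc : #M = t) :
    ∃ φ : (matching t).Copy H, ∀ x, (φ.mapEdgeSet x : Sym2 V) ∈ M := by
  classical
  let g : Fin t ≃ M := (Fintype.equivFinOfCardEq (by simpa using hc)).symm
  let p : Fin t × Fin 2 → V := fun x =>
    if x.2 = 0 then (Quot.out (g x.1 : Sym2 V)).1 else (Quot.out (g x.1 : Sym2 V)).2
  have hp : ∀ i, s(p (i, 0), p (i, 1)) = (g i : Sym2 V) := by
    intro i
    simp only [p, if_true, one_ne_zero, if_false]
    exact Quot.out_eq (g i : Sym2 V)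
  have hadj : ∀ i, H.Adj (p (i, 0)) (p (i, 1)) := by
    intro i
    rw [← SimpleGraph.mem_edgeSet, hp]
    exact hMH _ (g i).2
  have hmem : ∀ x, p x ∈ (g x.1 : Sym2 V) := by
    rintro ⟨i, a⟩
    rw [← hp]
    fin_cases a <;> simp
  refine ⟨⟨⟨p, ?_⟩, ?_⟩, ?_⟩
  · rintro ⟨i, a⟩ ⟨j, b⟩ ⟨h1, h2⟩
    simp only at h1 h2
    subst h1
    have h3 : a ≠ b := h2.ne
    fin_cases a <;> fin_cases b
    · exact absurd rfl h3
    · exact hadj i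
    · exact (hadj i).symm
    · exact absurd rfl h3
  · rintro ⟨i, a⟩ ⟨j, b⟩ hxy
    change p (i, a) = p (j, b) at hxy
    have hij : i = j := by
      refine g.injective (Subtype.ext ?_)
      exact hM _ (g i).2 _ (g j).2 (p (i, a)) (hmem (i, a)) (hxy ▸ hmem (j, b))
    subst hij
    have := (hadj i).ne
    fin_cases a <;> fin_cases b <;> simp_all
  · rintro ⟨x, hx⟩
    obtain ⟨i, rfl⟩ := exists_eq_of_mem_edgeSet_matching hx
    change s(p (i, 0), p (i, 1)) ∈ M
    rw [hp]
    exact (g i).2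

theorem free_matching_iff :
    (matching t).Free H ↔ ¬ ∃ M : Finset (Sym2 V),
      (∀ e ∈ M, e ∈ H.edgeSet) ∧ IsMatching M ∧ #M = t := by
  refine not_congr ⟨?_, ?_⟩
  · rintro ⟨φ⟩
    obtain ⟨M, h1, h2, h3⟩ := exists_isMatching_of_copy φ
    refine ⟨M, fun e he => ?_, h2, h3⟩
    obtain ⟨x, rfl⟩ := (h1 e).1 he
    exact (φ.mapEdgeSet x).2
  · rintro ⟨M, h1, h2, h3⟩
    obtain ⟨φ, -⟩ := h2.exists_copy h1 h3
    exact ⟨φ⟩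

theorem Avoids.exists_map (h : Avoids (matching t) H) :
    ∃ f : Sym2 V → Sym2 V, (∀ e ∈ H.edgeSet, f e ≠ e) ∧
      ∀ M : Finset (Sym2 V), (∀ e ∈ M, e ∈ H.edgeSet) → IsMatching M → #M = t →
        ∃ e ∈ M, f e ∈ M := by
  classical
  obtain ⟨f, hf, hφ⟩ := h
  -- The value off the edge set is arbitrary: both claims evaluate the map only at edges of `H`.
  refine ⟨fun e => if he : e ∈ H.edgeSet then f ⟨e, he⟩ else e, fun e he => ?_,
    fun M h1 h2 h3 => ?_⟩
  · simp only [he, dif_pos]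
    exact fun h => hf ⟨e, he⟩ (Subtype.ext h)
  · obtain ⟨φ, hφM⟩ := h2.exists_copy h1 h3
    have := hφ φ
    simp only [IsFreeCopy, not_forall, not_not] at this
    obtain ⟨x, y, hy⟩ := this
    refine ⟨_, hφM x, ?_⟩
    simp only [Subtype.coe_prop, dif_pos, Subtype.coe_eta, ← hy]
    exact hφM y

theorem avoids_of_map (f : Sym2 V → Sym2 V) (hf : ∀ e ∈ H.edgeSet, f e ∈ H.edgeSet ∧ f e ≠ e)
    (hM : ∀ M : Finset (Sym2 V), (∀ e ∈ M, e ∈ H.edgeSet) → IsMatching M → #M = t →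
      ∃ e ∈ M, f e ∈ M) : Avoids (matching t) H := by
  refine ⟨fun e => ⟨f e, (hf e e.2).1⟩, fun e h => (hf e e.2).2 (congrArg Subtype.val h),
    fun φ hφ => ?_⟩
  obtain ⟨M, h1, h2, h3⟩ := exists_isMatching_of_copy φ
  obtain ⟨e, he, hfe⟩ := hM M (fun e he => by
    obtain ⟨x, rfl⟩ := (h1 e).1 he
    exact (φ.mapEdgeSet x).2) h2 h3
  obtain ⟨x, rfl⟩ := (h1 e).1 he
  obtain ⟨y, hy⟩ := (h1 _).1 hfe
  exact hφ x ⟨y, Subtype.ext hy⟩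

end Copies

/-! ### Free transversals of stars and matchings by counting -/

section Transversal

/-- If each relation `R i j` relates every element to at most `d` elements of `S j` and the sets
`S i` are large, then some transversal of `S` avoids all the relations. -/
theorem exists_transversal {ι α : Type*} [Fintype ι] (S : ι → Finset α) (d : ℕ)
    (R : ι → ι → α → α → Prop)
    (hS : ∀ i, d * Fintype.card ι ^ 2 < #(S i))
    (hR : ∀ i j x, ∀ T ⊆ S j, (∀ y ∈ T, R i j x y) → #T ≤ d) :
    ∃ c : ι → α, (∀ i, c i ∈ S i) ∧ ∀ i j, i ≠ j → ¬ R i j (c i) (c j) := by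
  classical
  set t := Fintype.card ι with ht
  -- Trimming every set to the same size `L = d * t ^ 2 + 1` turns the count into powers of `L`:
  -- fewer than `L ^ t` choice functions are bad when `t > 0`.
  choose S' hS' hcard using fun i => exists_subset_card_eq (Nat.succ_le_of_lt (hS i))
  set L := (d * t ^ 2).succ with hL
  by_contra! hcon
  let bad : ι × ι → Finset (ι → α) := fun p =>
    (Fintype.piFinset S').filter fun c => R p.1 p.2 (c p.1) (c p.2)
  have hsub : Fintype.piFinset S' ⊆ (univ : Finset ι).offDiag.biUnion bad := by
    intro c hc
    obtain ⟨i, j, hij, hr⟩ := hcon c fun i => hS' i (Fintype.mem_piFinset.1 hc i)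
    exact mem_biUnion.2 ⟨(i, j), by simpa using hij, mem_filter.2 ⟨hc, hr⟩⟩
  have hbad : ∀ p ∈ (univ : Finset ι).offDiag, #(bad p) ≤ d * L ^ (t - 1) := by
    rintro ⟨i, j⟩ hp
    have hij : i ≠ j := by simpa using hp
    -- Forgetting coordinate `j` is at most `d`-to-one on bad functions, because `c i` is retained
    -- and leaves at most `d` related values for `c j`.
    let ρ : (ι → α) → ({k // k ≠ j} → α) := fun c k => c k
    have himg : #((bad (i, j)).image ρ) ≤ L ^ (t - 1) := by
      calc #((bad (i, j)).image ρ)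
          ≤ #(Fintype.piFinset fun k : {k // k ≠ j} => S' k) := by
            refine card_le_card ?_
            intro c hc
            obtain ⟨c', hc', rfl⟩ := mem_image.1 hc
            exact Fintype.mem_piFinset.2 fun k =>
              Fintype.mem_piFinset.1 (mem_filter.1 hc').1 k
        _ = L ^ (t - 1) := by
            simp only [Fintype.card_piFinset, hcard, prod_const, card_univ,
              Fintype.card_subtype_compl, Fintype.card_subtype_eq, t]
    refine (card_le_mul_card_image (f := ρ) _ d ?_).trans (Nat.mul_le_mul_left _ himg)
    intro a ha
    obtain ⟨c₀, -, rfl⟩ := mem_image.1 ha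
    have hval : ∀ c ∈ (bad (i, j)).filter fun c => ρ c = ρ c₀, ∀ k, k ≠ j → c k = c₀ k :=
      fun c hc k hk => congrFun (mem_filter.1 hc).2 ⟨k, hk⟩
    rw [← card_image_of_injOn (f := fun c : ι → α => c j)]
    · refine hR i j (c₀ i) _ ?_ ?_
      · intro y hy
        obtain ⟨c, hc, rfl⟩ := mem_image.1 hy
        exact hS' j (Fintype.mem_piFinset.1 (mem_filter.1 (mem_filter.1 hc).1).1 j)
      · intro y hy
        obtain ⟨c, hc, rfl⟩ := mem_image.1 hy
        rw [← hval c hc i hij]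
        exact (mem_filter.1 (mem_filter.1 hc).1).2
    · intro c hc c' hc' h
      ext k
      by_cases hk : k = j
      · subst hk; exact h
      · rw [hval c hc k hk, hval c' hc' k hk]
  have h1 : L ^ t ≤ #(univ : Finset ι).offDiag * (d * L ^ (t - 1)) := by
    calc L ^ t = #(Fintype.piFinset S') := by
          rw [Fintype.card_piFinset, prod_congr rfl fun k _ => hcard k, prod_const, card_univ]
      _ ≤ _ := (card_le_card hsub).trans (card_biUnion_le_card_mul _ _ _ hbad)
  have hLpos : 0 < L := Nat.succ_pos _
  rcases Nat.eq_zero_or_pos t with h0 | hpos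
  · have : IsEmpty ι := Fintype.card_eq_zero_iff.1 h0
    have hz : #(univ : Finset ι).offDiag = 0 := by simp
    rw [hz, h0] at h1
    simp at h1
  · have h2 : #(univ : Finset ι).offDiag ≤ t ^ 2 := by
      rw [offDiag_card, card_univ, ← ht, sq]
      exact Nat.sub_le _ _
    have h3 : L ^ t = L * L ^ (t - 1) := by
      rw [← pow_succ', Nat.sub_add_cancel hpos]
    have h4 : L * L ^ (t - 1) ≤ (d * t ^ 2) * L ^ (t - 1) := by
      calc L * L ^ (t - 1) ≤ _ := h3 ▸ h1
        _ ≤ t ^ 2 * (d * L ^ (t - 1)) := Nat.mul_le_mul_right _ h2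
        _ = _ := by ring
    have h5 := Nat.le_of_mul_le_mul_right h4 (pow_pos hLpos _)
    omega

variable {V : Type*}

/-- Large stars with distinct centres in `A` contain a matching with one edge from each star, no
edge of which is mapped by `f` to another. -/
theorem exists_matching_of_stars (A : Finset V) (f : Sym2 V → Sym2 V) (S : V → Finset V)
    (hS : ∀ a ∈ A, 2 * #A ^ 2 < #(S a)) (hSA : ∀ a ∈ A, ∀ b ∈ S a, b ∉ A) :
    ∃ M : Finset (Sym2 V), #M = #A ∧ IsMatching M ∧
      (∀ e ∈ M, ∃ a ∈ A, ∃ b ∈ S a, e = s(a, b)) ∧ ∀ e ∈ M, ∀ e' ∈ M, e ≠ e' → f e ≠ e' := by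
  classical
  -- Here `d = 2`: a leaf `x` excludes itself and at most one `y`, the other end of `f s(a, x)` if
  -- that edge contains `a'`.
  obtain ⟨c, hc, hcR⟩ := exists_transversal (ι := A) (fun a => S a) 2
    (fun a a' x y => x = y ∨ f s((a : V), x) = s((a' : V), y))
    (fun a => by simpa using hS a a.2) (by
      intro a a' x T _ hT
      have h : T ⊆ {x} ∪ T.filter fun y => f s((a : V), x) = s((a' : V), y) := by
        intro y hy
        rcases hT y hy with h | h
        · simp [h]
        · simp [h, hy]
      refine (card_le_card h).trans ((card_union_le _ _).trans ?_)
      have : #(T.filter fun y => f s((a : V), x) = s((a' : V), y)) ≤ 1 := by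
        refine card_le_one.2 fun y hy z hz => ?_
        have := (mem_filter.1 hy).2.symm.trans (mem_filter.1 hz).2
        exact Sym2.congr_right.1 this
      simpa [add_comm] using Nat.add_le_add_left this 1)
  have key : ∀ a b : A, ∀ v, v ∈ s((a : V), c a) → v ∈ s((b : V), c b) → a = b := by
    intro a b v ha hb
    by_contra hab
    rw [Sym2.mem_iff] at ha hb
    rcases ha with rfl | rfl <;> rcases hb with h | h
    · exact hab (Subtype.ext h)
    · exact hSA b b.2 _ (hc b) (h ▸ a.2)
    · exact hSA a a.2 _ (hc a) (h ▸ b.2)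
    · exact hcR a b hab (Or.inl h)
  refine ⟨univ.image fun a : A => s((a : V), c a), ?_, ?_, ?_, ?_⟩
  · rw [card_image_of_injective, card_univ, Fintype.card_coe]
    intro a b hab
    simp only at hab
    exact key a b a (by simp) (by rw [← hab]; simp)
  · intro e he e' he' v hv hv'
    simp only [mem_image, mem_univ, true_and] at he he'
    obtain ⟨i, rfl⟩ := he
    obtain ⟨j, rfl⟩ := he'
    rw [key i j v hv hv']
  · intro e he
    simp only [mem_image, mem_univ, true_and] at he
    obtain ⟨i, rfl⟩ := he
    exact ⟨i, i.2, c i, hc i, rfl⟩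
  · intro e he e' he' hne hfe
    simp only [mem_image, mem_univ, true_and] at he he'
    obtain ⟨i, rfl⟩ := he
    obtain ⟨j, rfl⟩ := he'
    exact hcR i j (fun h => hne (h ▸ rfl)) (Or.inr hfe)

/-- A large matching contains a submatching of size `t`, no edge of which is mapped by `f` to
another. -/
theorem IsMatching.exists_subset_free {M : Finset (Sym2 V)} (hM : IsMatching M)
    (f : Sym2 V → Sym2 V) (t : ℕ) (hc : 2 * t ^ 2 < #M) :
    ∃ M' ⊆ M, #M' = t ∧ IsMatching M' ∧ ∀ e ∈ M', ∀ e' ∈ M', e ≠ e' → f e ≠ e' := by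
  classical
  obtain ⟨c, hcM, hcR⟩ := exists_transversal (ι := Fin t) (fun _ => M) 2
    (fun _ _ x y => x = y ∨ f x = y) (fun _ => by simpa using hc) (by
      intro _ _ x T _ hT
      have h : T ⊆ {x, f x} := by
        intro y hy
        rcases hT y hy with h | h <;> simp [h]
      exact (card_le_card h).trans card_le_two)
  have hsub : univ.image c ⊆ M := by
    intro e he
    obtain ⟨i, -, rfl⟩ := mem_image.1 he
    exact hcM i
  refine ⟨univ.image c, hsub, ?_, fun e he e' he' => hM e (hsub he) e' (hsub he'), ?_⟩
  · rw [card_image_of_injective, card_univ, Fintype.card_fin]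
    intro i j hij
    by_contra h
    exact hcR i j h (Or.inl hij)
  · intro e he e' he' hne hfe
    obtain ⟨i, -, rfl⟩ := mem_image.1 he
    obtain ⟨j, -, rfl⟩ := mem_image.1 he'
    exact hcR i j (fun h => hne (h ▸ rfl)) (Or.inr hfe)

end Transversal

/-! ### Free matchings from vertices of large degree -/

section FreeMatchings

variable {V : Type*} [Fintype V] [DecidableEq V] {H : SimpleGraph V} [DecidableRel H.Adj]

theorem exists_free_matching_of_degree (f : Sym2 V → Sym2 V) (hf : ∀ e ∈ H.edgeSet, f e ≠ e)
    (A : Finset V) (hA : ∀ a ∈ A, 2 * #A ^ 2 + #A < H.degree a) :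
    ∃ M : Finset (Sym2 V), (∀ e ∈ M, e ∈ H.edgeSet) ∧ IsMatching M ∧ #M = #A ∧
      ∀ e ∈ M, f e ∉ M := by
  obtain ⟨M, h1, h2, h3, h4⟩ := exists_matching_of_stars A f (fun a => H.neighborFinset a \ A)
    (fun a ha => by
      have := le_card_sdiff A (H.neighborFinset a)
      rw [H.card_neighborFinset_eq_degree] at this
      have := hA a ha
      omega)
    (fun a _ b hb => (mem_sdiff.1 hb).2)
  have hME : ∀ e ∈ M, e ∈ H.edgeSet := by
    intro e he
    obtain ⟨a, -, b, hb, rfl⟩ := h3 e he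
    exact (H.mem_neighborFinset _ _).1 (mem_sdiff.1 hb).1
  exact ⟨M, hME, h2, h1, fun e he hfe => h4 e he _ hfe (hf e (hME e he)).symm rfl⟩

theorem exists_free_matching_of_edge (f : Sym2 V → Sym2 V) (hf : ∀ e ∈ H.edgeSet, f e ≠ e)
    (A : Finset V) {e₀ : Sym2 V} (he₀ : e₀ ∈ H.edgeSet) (he₀A : ∀ a ∈ A, a ∉ e₀)
    (hA : ∀ a ∈ A, 2 * #A ^ 2 + #A + 3 < #{b ∈ H.neighborFinset a | f s(a, b) ≠ e₀}) :
    ∃ M : Finset (Sym2 V), (∀ e ∈ M, e ∈ H.edgeSet) ∧ IsMatching M ∧ #M = #A + 1 ∧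
      ∀ e ∈ M, f e ∉ M := by
  obtain ⟨M, h1, h2, h3, h4⟩ := exists_matching_of_stars A f
    -- The extra deletions cost at most `#A + 3` leaves: `A`, the two ends of `e₀`, and the one `b`
    -- for which `f e₀` could be `s(a, b)`.
    (fun a => {b ∈ H.neighborFinset a | f s(a, b) ≠ e₀} \
      (A ∪ (e₀.toFinset ∪ univ.filter fun b => s(a, b) = f e₀)))
    (fun a ha => by
      have h1 := le_card_sdiff (A ∪ (e₀.toFinset ∪ univ.filter fun b => s(a, b) = f e₀))
        {b ∈ H.neighborFinset a | f s(a, b) ≠ e₀}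
      have h2 := card_union_le A (e₀.toFinset ∪ univ.filter fun b => s(a, b) = f e₀)
      have h3 := card_union_le e₀.toFinset (univ.filter fun b => s(a, b) = f e₀)
      have h4 : #e₀.toFinset ≤ 2 := by
        rw [Sym2.card_toFinset]; split_ifs <;> omega
      have h5 : #(univ.filter fun b => s(a, b) = f e₀) ≤ 1 := by
        refine card_le_one.2 fun y hy z hz => ?_
        exact Sym2.congr_right.1 ((mem_filter.1 hy).2.trans (mem_filter.1 hz).2.symm)
      have := hA a ha
      omega)
    (fun a _ b hb hbA => (mem_sdiff.1 hb).2 (mem_union_left _ hbA))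
  have hME : ∀ e ∈ M, e ∈ H.edgeSet ∧ f e ≠ e₀ ∧ f e₀ ≠ e ∧ ∀ v ∈ e, v ∉ e₀ := by
    intro e he
    obtain ⟨a, haA, b, hb, rfl⟩ := h3 e he
    simp only [mem_sdiff, mem_filter, SimpleGraph.mem_neighborFinset, mem_union, mem_univ,
      true_and, Sym2.mem_toFinset, not_or] at hb
    refine ⟨hb.1.1, hb.1.2, fun h => hb.2.2.2 h.symm, fun v hv => ?_⟩
    rcases Sym2.mem_iff.1 hv with rfl | rfl
    · exact he₀A _ haA
    · exact hb.2.2.1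
  have he₀M : e₀ ∉ M := by
    intro h
    induction e₀ with
    | _ x y => exact (hME _ h).2.2.2 x (by simp) (by simp)
  refine ⟨insert e₀ M, ?_, ?_, ?_, ?_⟩
  · intro e he
    rcases mem_insert.1 he with rfl | he
    · exact he₀
    · exact (hME e he).1
  · intro e he e' he' v hv hv'
    rcases mem_insert.1 he with h | h <;> rcases mem_insert.1 he' with h' | h'
    · rw [h, h']
    · exact absurd (h ▸ hv) ((hME _ h').2.2.2 v hv')
    · exact absurd (h' ▸ hv') ((hME _ h).2.2.2 v hv)
    · exact h2 e h e' h' v hv hv'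
  · rw [card_insert_of_notMem he₀M, h1]
  · intro e he hfe
    rcases mem_insert.1 he with rfl | he <;> rcases mem_insert.1 hfe with h | hfe
    · exact hf _ he₀ h
    · exact (hME _ hfe).2.2.1 rfl
    · exact (hME _ he).2.1 h
    · exact h4 e he _ hfe (hf e (hME e he).1).symm rfl

/-- If more edges than `#A` avoid `A`, then one of them is the image of at most half of the edges
at each vertex of `A`. -/
theorem exists_edge_of_card_lt (f : Sym2 V → Sym2 V) (A : Finset V) (F : Finset (Sym2 V))
    (hF : #A < #F) :
    ∃ e ∈ F, ∀ a ∈ A, H.degree a ≤ 2 * #{b ∈ H.neighborFinset a | f s(a, b) ≠ e} := by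
  obtain ⟨e₁, he₁⟩ := card_pos.1 (Nat.zero_lt_of_lt hF)
  have : Nonempty V := ⟨(Quot.out e₁).1⟩
  by_contra! hcon
  -- `g e` is a vertex of `A` with more than half of its edges mapped to `e`. By pigeonhole two
  -- edges share such a vertex, but the two majorities are disjoint.
  choose! g hg using hcon
  obtain ⟨e, he, e', he', hne, hgg⟩ := exists_ne_map_eq_of_card_lt_of_maps_to hF
    (f := g) (fun e he => (hg e he).1)
  have h1 := (hg e he).2
  have h2 := (hg e' he').2
  rw [← hgg] at h2
  have h3 : H.neighborFinset (g e) ⊆ {b ∈ H.neighborFinset (g e) | f s(g e, b) ≠ e} ∪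
      {b ∈ H.neighborFinset (g e) | f s(g e, b) ≠ e'} := by
    intro b hb
    rw [mem_union, mem_filter, mem_filter]
    by_cases h : f s(g e, b) = e
    · exact Or.inr ⟨hb, fun h' => hne (h.symm.trans h')⟩
    · exact Or.inl ⟨hb, h⟩
  have h4 := (card_le_card h3).trans (card_union_le _ _)
  rw [H.card_neighborFinset_eq_degree] at h4
  omega

end FreeMatchings

/-- Greedy choice: taking an edge discards at most `2 * K` edges, those at its two ends. -/
theorem exists_matching_of_bounded_degree {V : Type*} [DecidableEq V] (K N : ℕ) (hK : 0 < K) (F : Finset (Sym2 V))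
    (hdeg : ∀ v, #{e ∈ F | v ∈ e} ≤ K) (hF : N * (2 * K) ≤ #F) :
    ∃ M ⊆ F, IsMatching M ∧ #M = N := by
  induction N generalizing F with
  | zero => exact ⟨∅, by simp, by simp [IsMatching], rfl⟩
  | succ N ih =>
    have hpos : 0 < #F := by nlinarith
    obtain ⟨e, he⟩ := card_pos.1 hpos
    induction e with
    | _ x y =>
    have h1 : F ⊆ {e ∈ F | x ∉ e ∧ y ∉ e} ∪ ({e ∈ F | x ∈ e} ∪ {e ∈ F | y ∈ e}) := by
      intro e he
      simp only [mem_union, mem_filter, he, true_and]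
      tauto
    have h2 := (card_le_card h1).trans (card_union_le _ _)
    have h3 := card_union_le {e ∈ F | x ∈ e} {e ∈ F | y ∈ e}
    have h4 := hdeg x
    have h5 := hdeg y
    obtain ⟨M, hMF, hM, hMc⟩ := ih {e ∈ F | x ∉ e ∧ y ∉ e}
      (fun v => (card_le_card (filter_subset_filter _ (filter_subset _ _))).trans (hdeg v))
      (by rw [add_mul] at hF; omega)
    have hxy : ∀ e ∈ M, ∀ v ∈ e, v ∉ s(x, y) := by
      intro e he v hv hvxy
      have := (mem_filter.1 (hMF he)).2
      rcases Sym2.mem_iff.1 hvxy with rfl | rfl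
      · exact this.1 hv
      · exact this.2 hv
    have hnot : s(x, y) ∉ M := fun h => hxy _ h x (by simp) (by simp)
    refine ⟨insert s(x, y) M, ?_, ?_, ?_⟩
    · intro e h
      rcases mem_insert.1 h with rfl | h
      · exact he
      · exact (mem_filter.1 (hMF h)).1
    · intro e he e' he' v hv hv'
      rcases mem_insert.1 he with rfl | he <;> rcases mem_insert.1 he' with rfl | he'
      · rfl
      · exact absurd hv (hxy _ he' v hv')
      · exact absurd hv' (hxy _ he v hv)
      · exact hM e he e' he' v hv hv'
    · rw [card_insert_of_notMem hnot, hMc]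

/-! ### Counting the pairs that meet a vertex set -/

section EdgeCount

variable {V : Type*} [Fintype V] [DecidableEq V]

/-- The pairs of distinct vertices that meet `A`. -/
def touching (A : Finset V) : Finset (Sym2 V) :=
  (univ : Finset V).offDiag.image Sym2.mk.uncurry \ Aᶜ.offDiag.image Sym2.mk.uncurry

theorem mem_touching {A : Finset V} {e : Sym2 V} :
    e ∈ touching A ↔ ¬ e.IsDiag ∧ ∃ a ∈ A, a ∈ e := by
  induction e with
  | _ x y =>
    simp only [touching, mem_sdiff, mem_image, mem_offDiag, mem_univ, true_and, mem_compl,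
      Prod.exists, Sym2.mk_isDiag_iff, Sym2.mem_iff, Function.uncurry_apply_pair]
    constructor
    · rintro ⟨⟨a, b, hab, h⟩, h2⟩
      have hxy : x ≠ y := by
        rintro rfl
        rw [Sym2.eq_iff] at h
        rcases h with ⟨rfl, rfl⟩ | ⟨rfl, rfl⟩ <;> exact hab rfl
      refine ⟨hxy, ?_⟩
      by_contra! hc
      exact h2 ⟨x, y, ⟨fun h => (hc x h).1 rfl, fun h => (hc y h).2 rfl, hxy⟩, rfl⟩
    · rintro ⟨hxy, a, ha, h⟩
      refine ⟨⟨x, y, hxy, rfl⟩, ?_⟩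
      rintro ⟨u, v, ⟨hu, hv, -⟩, h'⟩
      rw [Sym2.eq_iff] at h'
      rcases h' with ⟨rfl, rfl⟩ | ⟨rfl, rfl⟩ <;> rcases h with rfl | rfl <;>
        first | exact hu ha | exact hv ha

theorem card_touching (A : Finset V) :
    #(touching A) = #A * (Fintype.card V - #A) + (#A).choose 2 := by
  have hsub : Aᶜ.offDiag.image Sym2.mk.uncurry ⊆
      (univ : Finset V).offDiag.image Sym2.mk.uncurry :=
    image_subset_image (offDiag_mono (subset_univ _))
  have h1 := Sym2.card_image_offDiag (univ : Finset V)
  have h2 := Sym2.card_image_offDiag Aᶜ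
  rw [touching, card_sdiff_of_subset hsub, h1, h2, card_univ, card_compl]
  have hle : #A ≤ Fintype.card V := card_le_univ A
  obtain ⟨k, hk⟩ := Nat.exists_eq_add_of_le hle
  rw [hk, Nat.add_sub_cancel_left]
  -- Vandermonde's identity: a pair has zero, one or two members in `A`.
  have : (#A + k).choose 2 = k.choose 2 + (#A * k + (#A).choose 2) := by
    rw [Nat.add_choose_eq]
    simp [Finset.Nat.antidiagonal_succ]
  omega

end EdgeCount

/-! ### Upper bounds for large `n` -/

section UpperBound

variable {V : Type*} [Fintype V] [DecidableEq V] {H : SimpleGraph V} [DecidableRel H.Adj]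

theorem card_edgeFinset_le_touching_add (A : Finset V) :
    #H.edgeFinset ≤ #A * (Fintype.card V - #A) + (#A).choose 2 +
      #{e ∈ H.edgeFinset | ∀ a ∈ A, a ∉ e} := by
  rw [← card_touching]
  refine (card_le_card ?_).trans (card_union_le _ _)
  intro e he
  rw [mem_union, mem_touching, mem_filter]
  by_cases h : ∃ a ∈ A, a ∈ e
  · exact Or.inl ⟨H.not_isDiag_of_mem_edgeSet (SimpleGraph.mem_edgeFinset.1 he), h⟩
  · push Not at h
    exact Or.inr ⟨he, h⟩

/-- A graph with more edges than the extremal number of `tK₂` has `t` vertices of large degree, or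
`t - 1` such vertices that leave some edges uncovered, or a large matching. -/
theorem exists_degree_or_matching (t K N r : ℕ) (ht : 1 ≤ t) (hK : 0 < K)
    (hn : t * t + N * (2 * K) + 2 * t ≤ Fintype.card V)
    (hm : (t - 1) * (Fintype.card V - t + 1) + (t - 1).choose 2 + r ≤ #H.edgeFinset) :
    (∃ A : Finset V, #A = t ∧ ∀ a ∈ A, K ≤ H.degree a) ∨
    (∃ A : Finset V, #A + 1 = t ∧ (∀ a ∈ A, K ≤ H.degree a) ∧
      r ≤ #{e ∈ H.edgeFinset | ∀ a ∈ A, a ∉ e}) ∨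
    ∃ M : Finset (Sym2 V), (∀ e ∈ M, e ∈ H.edgeSet) ∧ IsMatching M ∧ #M = N := by
  set A : Finset V := {v | K ≤ H.degree v} with hA
  have hmemA : ∀ v, v ∈ A ↔ K ≤ H.degree v := fun v => by simp [hA]
  have hcount := card_edgeFinset_le_touching_add (H := H) A
  rcases le_or_gt t #A with h | h
  · left
    obtain ⟨A', hA', hc⟩ := exists_subset_card_eq h
    exact ⟨A', hc, fun a ha => (hmemA a).1 (hA' ha)⟩
  right
  rcases Nat.eq_or_lt_of_le (Nat.succ_le_of_lt h) with h | h
  · left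
    refine ⟨A, h, fun a ha => (hmemA a).1 ha, ?_⟩
    have h1 : t - 1 = #A := by omega
    have h2 : Fintype.card V - t + 1 = Fintype.card V - #A := by
      have : t ≤ t * t := Nat.le_mul_self t
      omega
    rw [h1, h2] at hm
    omega
  · right
    obtain ⟨M, hMF, hM, hMc⟩ := exists_matching_of_bounded_degree K N hK
      {e ∈ H.edgeFinset | ∀ a ∈ A, a ∉ e} (fun v => by
        by_cases hv : v ∈ A
        · rw [filter_eq_empty_iff.2]
          · simp
          · intro e he
            exact (mem_filter.1 he).2 v hv
        · have h1 : H.degree v < K := by rwa [hmemA, not_le] at hv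
          refine le_trans ?_ h1.le
          rw [← H.card_incidenceFinset_eq_degree]
          refine card_le_card fun e he => ?_
          rw [mem_filter, mem_filter, SimpleGraph.mem_edgeFinset] at he
          rw [SimpleGraph.mem_incidenceFinset]
          exact ⟨he.1.1, he.2⟩) (by
        -- With `#A ≤ t - 2`, at most `(t - 2) * n` edges meet `A`, for `n = Fintype.card V`. The
        -- edge count has leading term `(t - 1) * n`, so about `n` edges miss `A`, and `hn` makes
        -- this at least `N * (2 * K)`.
        have h1 : #A * (Fintype.card V - #A) + (#A).choose 2 ≤ #A * Fintype.card V := by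
          have h2 : (#A).choose 2 ≤ #A * #A := by
            rw [Nat.choose_two_right]
            exact (Nat.div_le_self _ _).trans (Nat.mul_le_mul_left _ (Nat.sub_le _ _))
          have h3 : #A ≤ Fintype.card V := card_le_univ A
          calc _ ≤ #A * (Fintype.card V - #A) + #A * #A := by omega
            _ = #A * Fintype.card V := by rw [← mul_add, Nat.sub_add_cancel h3]
        obtain ⟨u, rfl⟩ : ∃ u, t = u + 2 := ⟨t - 2, by omega⟩
        obtain ⟨k, hk⟩ : ∃ k, Fintype.card V = k + (u + 2) := ⟨Fintype.card V - (u + 2), by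
          have := Nat.le_mul_self (u + 2)
          omega⟩
        have h4 : #A * Fintype.card V ≤ u * Fintype.card V := Nat.mul_le_mul_right _ (by omega)
        rw [hk, Nat.add_sub_cancel] at hm
        rw [hk] at h1 h4 hcount hn
        have h5 : u + 2 - 1 = u + 1 := rfl
        rw [h5] at hm
        nlinarith)
    exact ⟨M, fun e he => SimpleGraph.mem_edgeFinset.1 (mem_filter.1 (hMF he)).1, hM, hMc⟩

/-- A bound on the number of vertices beyond which the extremal results for `tK₂` hold. -/
def threshold (t : ℕ) : ℕ :=
  t * t + (2 * t ^ 2 + 1) * (2 * (2 * (2 * t ^ 2 + t + 4))) + 2 * t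

theorem card_edgeFinset_le_of_free (t : ℕ) (ht : 1 ≤ t) (hn : threshold t ≤ Fintype.card V)
    (hfree : (matching t).Free H) :
    #H.edgeFinset ≤ (t - 1) * (Fintype.card V - t + 1) + (t - 1).choose 2 := by
  by_contra! hm
  refine free_matching_iff.1 hfree ?_
  have : Nonempty V := Fintype.card_pos_iff.1 (by unfold threshold at hn; omega)
  obtain ⟨v⟩ := this
  -- A constant map to a loop never hits an edge, so the free-matching lemmas specialise to plain
  -- matchings.
  let f : Sym2 V → Sym2 V := fun _ => s(v, v)
  have hfd : ∀ e e', e' ∈ H.edgeSet → f e ≠ e' := by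
    rintro e _ he rfl
    exact H.not_isDiag_of_mem_edgeSet he (by simp [f])
  have hf : ∀ e ∈ H.edgeSet, f e ≠ e := fun e he => hfd e e he
  rcases exists_degree_or_matching t (2 * (2 * t ^ 2 + t + 4)) (2 * t ^ 2 + 1) 1 ht (by positivity)
    hn hm with ⟨A, hA, hdeg⟩ | ⟨A, hA, hdeg, hF⟩ | ⟨M, h1, h2, h3⟩
  · obtain ⟨M, h1, h2, h3, -⟩ := exists_free_matching_of_degree f hf A
      (fun a ha => by rw [hA]; have := hdeg a ha; omega)
    exact ⟨M, h1, h2, h3.trans hA⟩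
  · obtain ⟨e, he⟩ := card_pos.1 hF
    rw [mem_filter, SimpleGraph.mem_edgeFinset] at he
    obtain ⟨M, h1, h2, h3, -⟩ := exists_free_matching_of_edge f hf A he.1 he.2 (by
      intro a ha
      rw [filter_true_of_mem fun b _ => hfd s(a, b) _ he.1, H.card_neighborFinset_eq_degree]
      have := hdeg a ha
      have h4 : #A ^ 2 ≤ t ^ 2 := Nat.pow_le_pow_left (by omega) 2
      omega)
    exact ⟨M, h1, h2, h3.trans hA⟩
  · obtain ⟨M', hM', hc, hm', -⟩ := h2.exists_subset_free f t (by omega)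
    exact ⟨M', fun e he => h1 e (hM' he), hm', hc⟩

theorem card_edgeFinset_le_of_avoids (t : ℕ) (ht : 1 ≤ t) (hn : threshold t ≤ Fintype.card V)
    (havoid : Avoids (matching t) H) :
    #H.edgeFinset ≤ (t - 1) * (Fintype.card V - t + 1) + (t - 1).choose 2 + (t - 1) := by
  by_contra! hm
  obtain ⟨f, hf, hfM⟩ := havoid.exists_map
  suffices h : ∃ M : Finset (Sym2 V), (∀ e ∈ M, e ∈ H.edgeSet) ∧ IsMatching M ∧ #M = t ∧
      ∀ e ∈ M, f e ∉ M by
    obtain ⟨M, h1, h2, h3, h4⟩ := h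
    obtain ⟨e, he, hfe⟩ := hfM M h1 h2 h3
    exact h4 e he hfe
  -- The degree bound is doubled because only half of each star is guaranteed not to map to the
  -- chosen edge. The matching size exceeds the `2 * t ^ 2` needed by `exists_subset_free`, and `r =
  -- t` gives more excess edges than `#A = t - 1`.
  rcases exists_degree_or_matching t (2 * (2 * t ^ 2 + t + 4)) (2 * t ^ 2 + 1) t ht (by positivity)
    hn (H := H) (by omega) with ⟨A, hA, hdeg⟩ | ⟨A, hA, hdeg, hF⟩ | ⟨M, h1, h2, h3⟩
  · obtain ⟨M, h1, h2, h3, h4⟩ := exists_free_matching_of_degree f hf A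
      (fun a ha => by rw [hA]; have := hdeg a ha; omega)
    exact ⟨M, h1, h2, h3.trans hA, h4⟩
  · obtain ⟨e, he, heA⟩ := exists_edge_of_card_lt (H := H) f A
      {e ∈ H.edgeFinset | ∀ a ∈ A, a ∉ e} (by omega)
    rw [mem_filter, SimpleGraph.mem_edgeFinset] at he
    obtain ⟨M, h1, h2, h3, h4⟩ := exists_free_matching_of_edge f hf A he.1 he.2 (by
      intro a ha
      have := hdeg a ha
      have := heA a ha
      have h4 : #A ^ 2 ≤ t ^ 2 := Nat.pow_le_pow_left (by omega) 2
      omega)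
    exact ⟨M, h1, h2, h3.trans hA, h4⟩
  · obtain ⟨M', hM', hc, hm', h4⟩ := h2.exists_subset_free f t (by omega)
    have h5 : ∀ e ∈ M', e ∈ H.edgeSet := fun e he => h1 e (hM' he)
    exact ⟨M', h5, hm', hc, fun e he hfe => h4 e he _ hfe (hf e (h5 e he)).symm rfl⟩

end UpperBound

/-! ### Constructions for general `t` -/

section LowerBound

/-- A matching each of whose edges meets `A` has at most `#A` edges. -/
theorem IsMatching.card_le_of_forall_mem {V : Type*} {M : Finset (Sym2 V)} (hM : IsMatching M) {A : Finset V}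
    {w : Sym2 V → V} (hw : ∀ e ∈ M, w e ∈ A ∧ w e ∈ e) : #M ≤ #A :=
  card_le_card_of_injOn w (fun e he => (hw e he).1) fun e he e' he' h =>
    hM e he e' he' (w e) (hw e he).2 (h ▸ (hw e' he').2)

theorem le_extremalNumber (n t : ℕ) (ht : 1 ≤ t) (hn : t ≤ n) :
    (t - 1) * (n - t + 1) + (t - 1).choose 2 ≤
      SimpleGraph.extremalNumber n (matching t) := by
  classical
  obtain ⟨A, -, hA⟩ := exists_subset_card_eq (s := (univ : Finset (Fin n))) (n := t - 1)
    (by simp; omega)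
  obtain ⟨H, hE⟩ : ∃ H : SimpleGraph (Fin n), ∀ e, e ∈ H.edgeSet ↔ e ∈ touching A := by
    refine ⟨SimpleGraph.fromEdgeSet (touching A : Set (Sym2 (Fin n))), fun e => ?_⟩
    simp only [SimpleGraph.edgeSet_fromEdgeSet, Set.mem_sdiff, mem_coe, Sym2.mem_diagSet]
    exact and_iff_left_of_imp fun h => (mem_touching.1 h).1
  have hfree : (matching t).Free H := by
    refine free_matching_iff.2 ?_
    rintro ⟨M, h1, h2, h3⟩
    have h4 : ∀ e ∈ M, ∃ a, a ∈ A ∧ a ∈ e := fun e he =>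
      (mem_touching.1 ((hE e).1 (h1 e he))).2
    have : Nonempty (Fin n) := ⟨⟨0, by omega⟩⟩
    choose! w hw using h4
    have := h2.card_le_of_forall_mem hw
    omega
  have h1 := SimpleGraph.card_edgeFinset_le_extremalNumber hfree
  have h2 : H.edgeFinset = touching A := by
    ext e
    rw [SimpleGraph.mem_edgeFinset, hE]
  rw [h2, card_touching, hA, Fintype.card_fin] at h1
  rwa [show n - t + 1 = n - (t - 1) by omega]

/-- The extra star at `c` has one leaf `d a` per `a ∈ A`, and an edge meeting `A` at its selected
vertex `a` is mapped to `s(c, d a)`. A `t`-matching needs exactly one star edge `s(c, d b)`; its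
other `t - 1` edges select every vertex of `A`, including `b`. The vertices used number `(t - 1) + 1
+ (t - 1) = 2 * t - 1`. -/
theorem mem_hSet_matching (n t : ℕ) (ht : 2 ≤ t) (hn : 2 * t - 1 ≤ n) :
    (t - 1) * (n - t + 1) + (t - 1).choose 2 + (t - 1) ∈ hSet n (matching t) := by
  classical
  let A : Finset (Fin n) := univ.filter fun v => (v : ℕ) < t - 1
  have hmA : ∀ v : Fin n, v ∈ A ↔ (v : ℕ) < t - 1 := fun v => by simp [A]
  have hA : #A = t - 1 := by
    simp only [A]
    rw [Fin.card_filter_val_lt]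
    omega
  let c : Fin n := ⟨t - 1, by omega⟩
  let a₀ : Fin n := ⟨0, by omega⟩
  let d : Fin n → Fin n := fun a => if h : (a : ℕ) < t - 1 then ⟨t + a, by omega⟩ else a
  have hd : ∀ a ∈ A, ((d a : Fin n) : ℕ) = t + a := by
    intro a ha
    simp [d, (hmA a).1 ha]
  have hcA : c ∉ A := by rw [hmA]; simp [c]
  have ha₀A : a₀ ∈ A := by rw [hmA]; simp only [a₀]; omega
  have hdA : ∀ a ∈ A, d a ∉ A := by
    intro a ha
    rw [hmA, hd a ha]
    omega
  have hcd : ∀ a ∈ A, c ≠ d a := by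
    intro a ha h
    have := congrArg Fin.val h
    rw [hd a ha] at this
    simp only [c] at this
    omega
  have hdinj : Set.InjOn (fun a => s(c, d a)) (A : Set (Fin n)) := by
    intro a ha b hb hab
    have h := congrArg Fin.val (Sym2.congr_right.1 hab)
    rw [hd a ha, hd b hb] at h
    exact Fin.ext (by omega)
  let X : Finset (Sym2 (Fin n)) := A.image fun a => s(c, d a)
  have hX : ∀ e ∈ X, ∀ a ∈ A, a ∉ e := by
    intro e he a ha hae
    obtain ⟨b, hb, rfl⟩ := mem_image.1 he
    rcases Sym2.mem_iff.1 hae with rfl | rfl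
    · exact hcA ha
    · exact hdA b hb ha
  have hdisj : Disjoint (touching A) X := by
    rw [disjoint_left]
    intro e he heX
    obtain ⟨-, a, ha, hae⟩ := mem_touching.1 he
    exact hX e heX a ha hae
  let H : SimpleGraph (Fin n) := SimpleGraph.fromEdgeSet (touching A ∪ X : Finset (Sym2 (Fin n)))
  have hE : ∀ e, e ∈ H.edgeSet ↔ e ∈ touching A ∪ X := by
    intro e
    simp only [H, SimpleGraph.edgeSet_fromEdgeSet, Set.mem_sdiff, mem_coe, Sym2.mem_diagSet]
    refine and_iff_left_of_imp fun h => ?_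
    rcases mem_union.1 h with h | h
    · exact (mem_touching.1 h).1
    · obtain ⟨a, ha, rfl⟩ := mem_image.1 h
      simpa using hcd a ha
  let w : Sym2 (Fin n) → Fin n := fun e => if h : ∃ a, a ∈ A ∧ a ∈ e then h.choose else a₀
  have hw : ∀ e ∈ touching A, w e ∈ A ∧ w e ∈ e := by
    intro e he
    have h : ∃ a, a ∈ A ∧ a ∈ e := (mem_touching.1 he).2
    simp only [w, h, dif_pos]
    exact h.choose_spec
  let f : Sym2 (Fin n) → Sym2 (Fin n) := fun e =>
    if e ∈ touching A then s(c, d (w e)) else s(a₀, c)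
  have hXmem : ∀ a ∈ A, s(c, d a) ∈ X := fun a ha => mem_image_of_mem (fun a => s(c, d a)) ha
  have hac : s(a₀, c) ∈ touching A := by
    refine mem_touching.2 ⟨?_, a₀, ha₀A, by simp⟩
    rw [Sym2.mk_isDiag_iff]
    rintro h
    exact hcA (h ▸ ha₀A)
  refine ⟨H, ?_, avoids_of_map f ?_ ?_⟩
  · have h1 : H.edgeSet = ((touching A ∪ X : Finset (Sym2 (Fin n))) : Set (Sym2 (Fin n))) := by
      ext e
      rw [hE, mem_coe]
    rw [h1, Set.ncard_coe_finset, card_union_of_disjoint hdisj, card_touching,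
      card_image_of_injOn hdinj, hA, Fintype.card_fin, show n - t + 1 = n - (t - 1) by omega]
  · intro e he
    rw [hE]
    by_cases h : e ∈ touching A
    · simp only [f, h, if_true]
      have hx := hXmem _ (hw e h).1
      exact ⟨mem_union_right _ hx, fun h' => disjoint_left.1 hdisj h (h' ▸ hx)⟩
    · simp only [f, h, if_false]
      exact ⟨mem_union_left _ hac, fun h' => h (h' ▸ hac)⟩
  · intro M h1 h2 h3
    have h4 : ∃ e ∈ M, e ∉ touching A := by
      by_contra! hcon
      have := h2.card_le_of_forall_mem fun e he => hw e (hcon e he)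
      omega
    obtain ⟨e₀, he₀, he₀A⟩ := h4
    have h5 : ∀ e ∈ M, e ∉ touching A → e ∈ X := fun e he h =>
      (mem_union.1 ((hE e).1 (h1 e he))).resolve_left h
    obtain ⟨b, hb, rfl⟩ := mem_image.1 (h5 e₀ he₀ he₀A)
    have h6 : ∀ e ∈ M.erase s(c, d b), e ∈ touching A := by
      intro e he
      by_contra h
      obtain ⟨b', hb', rfl⟩ := mem_image.1 (h5 e (mem_erase.1 he).2 h)
      exact (mem_erase.1 he).1 (h2 _ (mem_erase.1 he).2 _ he₀ c (by simp) (by simp))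
    have h7 : Set.SurjOn w (M.erase s(c, d b)) A := by
      refine surjOn_of_injOn_of_card_le w (fun e he => (hw e (h6 e he)).1) ?_ ?_
      · intro e he e' he' h
        exact h2 e (mem_erase.1 he).2 e' (mem_erase.1 he').2 (w e) (hw e (h6 e he)).2
          (h ▸ (hw e' (h6 e' he')).2)
      · rw [card_erase_of_mem he₀, hA, h3]
    obtain ⟨e, he, hwe⟩ := h7 hb
    refine ⟨e, (mem_erase.1 he).2, ?_⟩
    simp only [f, h6 e he, if_true, hwe]
    exact he₀

end LowerBound

/-! ### The upper bound `max n 7` for `2K₂` -/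

section TwoEdges

variable {V : Type*}

theorem isMatching_pair [DecidableEq V] {e e' : Sym2 V} (h : ∀ v ∈ e, v ∉ e') :
    IsMatching {e, e'} := by
  intro x hx y hy v hvx hvy
  rw [mem_insert, mem_singleton] at hx hy
  rcases hx with rfl | rfl <;> rcases hy with rfl | rfl
  · rfl
  · exact absurd hvy (h v hvx)
  · exact absurd hvx (h v hvy)
  · rfl

theorem ne_of_forall_notMem {e e' : Sym2 V} (h : ∀ v ∈ e, v ∉ e') : e ≠ e' := by
  rintro rfl
  induction e with
  | _ x y => exact h x (by simp) (by simp)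

/-- For `t = 2`, of two disjoint edges one is mapped to the other. -/
theorem Avoids.exists_map_two {H : SimpleGraph V} (h : Avoids (matching 2) H) :
    ∃ f : Sym2 V → Sym2 V, ∀ e ∈ H.edgeSet, ∀ e' ∈ H.edgeSet, (∀ v ∈ e, v ∉ e') →
      f e = e' ∨ f e' = e := by
  classical
  obtain ⟨f, hf, hM⟩ := h.exists_map
  refine ⟨f, fun e he e' he' hd => ?_⟩
  obtain ⟨x, hx, hfx⟩ := hM {e, e'} (by
      intro x hx
      rw [mem_insert, mem_singleton] at hx
      rcases hx with rfl | rfl <;> assumption)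
    (isMatching_pair hd) (card_pair (ne_of_forall_notMem hd))
  rw [mem_insert, mem_singleton] at hx hfx
  rcases hx with rfl | rfl <;> rcases hfx with h | h
  · exact absurd h (hf _ he)
  · exact Or.inl h
  · exact Or.inr h
  · exact absurd h (hf _ he')

theorem avoids_two_of_map {H : SimpleGraph V} (f : Sym2 V → Sym2 V)
    (hf : ∀ e ∈ H.edgeSet, f e ∈ H.edgeSet ∧ f e ≠ e)
    (hd : ∀ e ∈ H.edgeSet, ∀ e' ∈ H.edgeSet, (∃ v ∈ e, v ∈ e') ∨ f e = e' ∨ f e' = e) :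
    Avoids (matching 2) H := by
  classical
  refine avoids_of_map f hf fun M h1 h2 h3 => ?_
  obtain ⟨e, e', hne, rfl⟩ := card_eq_two.1 h3
  rcases hd e (h1 e (by simp)) e' (h1 e' (by simp)) with ⟨v, hv, hv'⟩ | h | h
  · exact absurd (h2 e (by simp) e' (by simp) v hv hv') hne
  · exact ⟨e, by simp, by simp [h]⟩
  · exact ⟨e', by simp, by simp [h]⟩

variable [DecidableEq V]

/-- Each disjoint pair consisting of an edge `vx` of a star and an edge `g` is charged to the one
that is mapped to the other. -/
theorem card_star_pairs_le (f : Sym2 V → Sym2 V) (v : V) (N : Finset V) (T : Finset (Sym2 V))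
    (h : ∀ x ∈ N, ∀ g ∈ T, x ∉ g → f s(v, x) = g ∨ f g = s(v, x)) :
    #{p ∈ N ×ˢ T | p.1 ∉ p.2} ≤ #N + #{g ∈ T | ∃ x ∈ N, f g = s(v, x)} := by
  rw [← card_disjSum]
  refine card_le_card_of_injOn
    (fun p => if f s(v, p.1) = p.2 then Sum.inl p.1 else Sum.inr p.2) ?_ ?_
  · rintro ⟨x, g⟩ hp
    simp only [coe_filter, mem_product, Set.mem_ofPred_eq] at hp
    by_cases hfx : f s(v, x) = g
    · simp [hfx, hp.1.1]
    · simp only [hfx, if_false, mem_coe, inr_mem_disjSum, mem_filter]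
      exact ⟨hp.1.2, x, hp.1.1, (h x hp.1.1 g hp.1.2 hp.2).resolve_left hfx⟩
  · rintro ⟨x, g⟩ hp ⟨y, k⟩ hq heq
    simp only [coe_filter, mem_product, Set.mem_ofPred_eq] at hp hq
    simp only at heq
    split_ifs at heq with h1 h2 h2
    · have hxy : x = y := Sum.inl.inj heq
      subst hxy
      rw [← h1, ← h2]
    · have hgk : g = k := Sum.inr.inj heq
      subst hgk
      have h3 := (h x hp.1.1 g hp.1.2 hp.2).resolve_left h1
      have h4 := (h y hq.1.1 g hq.1.2 hq.2).resolve_left h2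
      rw [Sym2.congr_right.1 (h3.symm.trans h4)]

theorem mul_le_card_star_pairs (N : Finset V) (T : Finset (Sym2 V)) (k : ℕ)
    (h : ∀ g ∈ T, k ≤ #{x ∈ N | x ∉ g}) : #T * k ≤ #{p ∈ N ×ˢ T | p.1 ∉ p.2} := by
  have h1 : #{p ∈ N ×ˢ T | p.1 ∉ p.2} = ∑ g ∈ T, #{x ∈ N | x ∉ g} := by
    rw [card_filter, sum_product_right]
    refine sum_congr rfl fun g _ => ?_
    rw [card_filter]
  rw [h1, ← smul_eq_mul]
  exact card_nsmul_le_sum _ _ _ h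

theorem card_sub_le_card_filter (N B : Finset V) (g : Sym2 V) (hB : ∀ x ∈ N, x ∈ g → x ∈ B) :
    #N - #B ≤ #{x ∈ N | x ∉ g} := by
  refine (le_card_sdiff B N).trans (card_le_card fun x hx => ?_)
  rw [mem_sdiff] at hx
  exact mem_filter.2 ⟨hx.1, fun h => hx.2 (hB x hx.1 h)⟩

theorem card_toFinset_le_two (g : Sym2 V) : #g.toFinset ≤ 2 := by
  rw [Sym2.card_toFinset]; split_ifs <;> omega

/-- At least four pairwise intersecting edges have a common vertex. -/
theorem exists_common_mem (T : Finset (Sym2 V)) (hT : 4 ≤ #T)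
    (hdiag : ∀ e ∈ T, ¬ e.IsDiag)
    (hint : ∀ e ∈ T, ∀ e' ∈ T, ∃ v ∈ e, v ∈ e') : ∃ u, ∀ e ∈ T, u ∈ e := by
  by_contra! hcon
  obtain ⟨e, he⟩ := card_pos.1 (by omega : 0 < #T)
  induction e with
  | _ x y =>
  obtain ⟨g₁, hg₁, hyg⟩ := hcon y
  obtain ⟨g₂, hg₂, hxg⟩ := hcon x
  have hx1 : x ∈ g₁ := by
    obtain ⟨v, hv, hv'⟩ := hint _ he _ hg₁
    rcases Sym2.mem_iff.1 hv with rfl | rfl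
    · exact hv'
    · exact absurd hv' hyg
  have hy2 : y ∈ g₂ := by
    obtain ⟨v, hv, hv'⟩ := hint _ he _ hg₂
    rcases Sym2.mem_iff.1 hv with rfl | rfl
    · exact absurd hv' hxg
    · exact hv'
  obtain ⟨z, rfl⟩ := hx1
  obtain ⟨w, rfl⟩ := hy2
  have hxy : x ≠ y := by simpa using hdiag _ he
  simp only [Sym2.mem_iff, not_or] at hyg hxg
  -- `g₁` misses `y` and `g₂` misses `x`, so they can meet only in a third vertex. The three edges
  -- form a triangle, and no fourth edge meets all its sides.
  have hzw : z = w := by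
    obtain ⟨v, hv, hv'⟩ := hint _ hg₁ _ hg₂
    rw [Sym2.mem_iff] at hv hv'
    grind
  subst hzw
  have hsub : ¬ T ⊆ {s(x, y), s(x, z), s(y, z)} := fun h => by
    have := (card_le_card h).trans card_le_three
    omega
  obtain ⟨g, hg, hgn⟩ := not_subset.1 hsub
  have h1 := hint _ hg _ he
  have h2 := hint _ hg _ hg₁
  have h3 := hint _ hg _ hg₂
  clear hT hcon hsub hint hdiag he hg₁ hg₂ hg
  induction g with
  | _ p q =>
  simp only [mem_insert, mem_singleton, Sym2.eq_iff, Sym2.mem_iff, not_or, not_and] at *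
  obtain ⟨a, ha, ha'⟩ := h1
  obtain ⟨b, hb, hb'⟩ := h2
  obtain ⟨c, hc, hc'⟩ := h3
  grind

variable [Fintype V] {H : SimpleGraph V} [DecidableRel H.Adj]

theorem card_edgeFinset_le_of_degree_le_three (f : Sym2 V → Sym2 V)
    (hf : ∀ e ∈ H.edgeSet, ∀ e' ∈ H.edgeSet, (∀ v ∈ e, v ∉ e') → f e = e' ∨ f e' = e)
    (hdeg : ∀ v, H.degree v ≤ 3) : #H.edgeFinset ≤ 7 := by
  set E := H.edgeFinset with hE
  have hmem : ∀ {e}, e ∈ E → e ∈ H.edgeSet := fun h => SimpleGraph.mem_edgeFinset.1 h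
  have hupper : #{p ∈ E ×ˢ E | ∀ v ∈ p.1, v ∉ p.2} ≤ #E + #E := by
    have hsub : {p ∈ E ×ˢ E | ∀ v ∈ p.1, v ∉ p.2} ⊆
        E.image (fun e => (e, f e)) ∪ E.image (fun e => (f e, e)) := by
      rintro ⟨e, e'⟩ hp
      rw [mem_filter, mem_product] at hp
      rw [mem_union, mem_image, mem_image]
      rcases hf e (hmem hp.1.1) e' (hmem hp.1.2) hp.2 with h | h
      · exact Or.inl ⟨e, hp.1.1, by rw [h]⟩
      · exact Or.inr ⟨e', hp.1.2, by rw [h]⟩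
    exact (card_le_card hsub).trans ((card_union_le _ _).trans
      (Nat.add_le_add card_image_le card_image_le))
  -- With degrees at most 3, an edge meets at most 5 edges, itself included.
  have hlower : #E * (#E - 5) ≤ #{p ∈ E ×ˢ E | ∀ v ∈ p.1, v ∉ p.2} := by
    have h1 : #{p ∈ E ×ˢ E | ∀ v ∈ p.1, v ∉ p.2} =
        ∑ e ∈ E, #{e' ∈ E | ∀ v ∈ e, v ∉ e'} := by
      rw [card_filter, sum_product]
      refine sum_congr rfl fun g _ => ?_
      rw [card_filter]
    rw [h1, ← smul_eq_mul]
    refine card_nsmul_le_sum _ _ _ fun e he => ?_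
    induction e with
    | _ x y =>
    have h2 : E \ (H.incidenceFinset x ∪ (H.incidenceFinset y).erase s(x, y)) ⊆
        {e' ∈ E | ∀ v ∈ s(x, y), v ∉ e'} := by
      intro e' he'
      simp only [mem_sdiff, mem_union, mem_erase, SimpleGraph.mem_incidenceFinset, not_or,
        not_and, SimpleGraph.incidenceSet, Set.mem_ofPred_eq] at he'
      have hxe : x ∉ e' := he'.2.1 (hmem he'.1)
      refine mem_filter.2 ⟨he'.1, fun v hv => ?_⟩
      rcases Sym2.mem_iff.1 hv with rfl | rfl
      · exact hxe
      · exact he'.2.2 (by rintro rfl; exact hxe (by simp)) (hmem he'.1)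
    have h3 := le_card_sdiff (H.incidenceFinset x ∪ (H.incidenceFinset y).erase s(x, y)) E
    have h4 := card_union_le (H.incidenceFinset x) ((H.incidenceFinset y).erase s(x, y))
    have h5 : s(x, y) ∈ H.incidenceFinset y := by
      rw [SimpleGraph.mem_incidenceFinset]
      exact ⟨hmem he, by simp⟩
    rw [card_erase_of_mem h5, H.card_incidenceFinset_eq_degree,
      H.card_incidenceFinset_eq_degree] at h4
    have h6 := hdeg x
    have h7 := hdeg y
    exact le_trans (by omega) (card_le_card h2)
  by_contra! hcon
  have h3 : 3 ≤ #E - 5 := by omega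
  have := Nat.mul_le_mul_left #E h3
  omega

/-- Let `v` have maximum degree `D ≥ 4`, with `k` edges missing `v`. Charging disjoint pairs gives
`k * (D - 2) ≤ D + k`. If the bound failed then `k ≥ 2` and `D + k ≥ 8`, leaving only `(D, k) = (4,
4)` and `(6, 2)`. Both are equality cases, which force the `k` edges to intersect pairwise. -/
theorem card_edgeFinset_le_of_avoids_two [Nonempty V] (h : Avoids (matching 2) H) :
    #H.edgeFinset ≤ max (Fintype.card V) 7 := by
  obtain ⟨f, hf⟩ := h.exists_map_two
  by_cases hdeg : ∀ v, H.degree v ≤ 3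
  · exact (card_edgeFinset_le_of_degree_le_three f hf hdeg).trans (le_max_right _ _)
  push Not at hdeg
  obtain ⟨v, hv⟩ := H.exists_maximal_degree_vertex
  have hmax : ∀ u, H.degree u ≤ H.degree v := fun u => hv ▸ H.degree_le_maxDegree u
  have hD : 4 ≤ H.degree v := by
    obtain ⟨u, hu⟩ := hdeg
    exact hu.trans_le (hmax u)
  have hDV := H.degree_lt_card_verts v
  set N := H.neighborFinset v with hN
  have hNc : #N = H.degree v := H.card_neighborFinset_eq_degree v
  have hNadj : ∀ x ∈ N, H.Adj v x := fun x hx => (H.mem_neighborFinset v x).1 hx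
  set T := {e ∈ H.edgeFinset | v ∉ e} with hT
  have hTm : ∀ g ∈ T, g ∈ H.edgeSet ∧ v ∉ g := fun g hg => by
    rwa [hT, mem_filter, SimpleGraph.mem_edgeFinset] at hg
  have hcard : #H.edgeFinset = H.degree v + #T := by
    rw [← card_filter_add_card_filter_not (s := H.edgeFinset) (fun e => v ∈ e),
      ← H.card_incidenceFinset_eq_degree, H.incidenceFinset_eq_filter]
  have hpair : ∀ x ∈ N, ∀ g ∈ T, x ∉ g → f s(v, x) = g ∨ f g = s(v, x) := by
    intro x hx g hg hxg
    refine hf _ (hNadj x hx) _ (hTm g hg).1 fun w hw => ?_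
    rcases Sym2.mem_iff.1 hw with rfl | rfl
    · exact (hTm g hg).2
    · exact hxg
  have hmiss : ∀ g : Sym2 V, #N - 2 ≤ #{x ∈ N | x ∉ g} := fun g =>
    (Nat.sub_le_sub_left (card_toFinset_le_two g) _).trans
      (card_sub_le_card_filter N g.toFinset g fun x _ hx => Sym2.mem_toFinset.2 hx)
  have hcount := (mul_le_card_star_pairs N T _ fun g _ => hmiss g).trans
    (card_star_pairs_le f v N T hpair)
  have hle : #{g ∈ T | ∃ x ∈ N, f g = s(v, x)} ≤ #T := card_filter_le _ _
  -- At equality every edge of `T` is mapped to a star edge at `v`, so none is mapped into `T` and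
  -- no two can be disjoint.
  have hint : #N + #T ≤ #T * (#N - 2) → ∀ g ∈ T, ∀ g' ∈ T, ∃ w ∈ g, w ∈ g' := by
    intro hge
    have heq : {g ∈ T | ∃ x ∈ N, f g = s(v, x)} = T :=
      eq_of_subset_of_card_le (filter_subset _ _) (by omega)
    have hnot : ∀ g ∈ T, ∀ g' ∈ T, f g ≠ g' := by
      rintro g hg g' hg' rfl
      rw [← heq] at hg
      obtain ⟨x, -, hx⟩ := (mem_filter.1 hg).2
      exact (hTm _ hg').2 (by rw [hx]; simp)
    intro g hg g' hg'
    by_contra! hd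
    rcases hf g (hTm g hg).1 g' (hTm g' hg').1 hd with h | h
    · exact hnot g hg g' hg' h
    · exact hnot g' hg' g hg h
  by_contra! hcon
  rw [max_lt_iff] at hcon
  rw [hcard] at hcon
  rw [hNc] at hcount hint
  generalize H.degree v = D at *
  have hk : 2 ≤ #T := by omega
  have hD6 : D ≤ 6 := by
    by_contra! h7
    obtain ⟨j, rfl⟩ : ∃ j, D = j + 7 := ⟨D - 7, by omega⟩
    have : j + 7 - 2 = j + 5 := by omega
    rw [this] at hcount
    nlinarith
  have hDcases : D = 4 ∨ D = 5 ∨ D = 6 := by omega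
  rcases hDcases with rfl | rfl | rfl
  · have hk4 : #T = 4 := by omega
    have hint' := hint (by omega)
    obtain ⟨u, hu⟩ := exists_common_mem T hk4.ge
      (fun e he => H.not_isDiag_of_mem_edgeSet (hTm e he).1) hint'
    -- If `u` is a neighbour of `v`, its degree is at least 5, beating the maximum. Otherwise each
    -- edge of `T` misses 3 of the 4 neighbours, and the pair count `12 ≤ 8` fails.
    by_cases huN : u ∈ N
    · have h5 : #(insert s(v, u) T) ≤ H.degree u := by
        rw [← H.card_incidenceFinset_eq_degree]
        refine card_le_card fun e he => ?_
        rw [SimpleGraph.mem_incidenceFinset]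
        rcases mem_insert.1 he with rfl | he
        · exact ⟨hNadj u huN, by simp⟩
        · exact ⟨(hTm e he).1, hu e he⟩
      rw [card_insert_of_notMem fun h => (hTm _ h).2 (by simp)] at h5
      have := hmax u
      omega
    · have h6 := (mul_le_card_star_pairs N T 3 fun g hg => by
        obtain ⟨w, rfl⟩ := hu g hg
        refine le_trans ?_ (card_sub_le_card_filter N {w} _ fun x hx hxg => ?_)
        · simp [hNc]
        · rcases Sym2.mem_iff.1 hxg with rfl | rfl
          · exact absurd hx huN
          · simp).trans (card_star_pairs_le f v N T hpair)
      omega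
  · omega
  · have hk2 : #T = 2 := by omega
    have hint' := hint (by omega)
    obtain ⟨g, g', hne, hTeq⟩ := card_eq_two.1 hk2
    obtain ⟨u, hug, hug'⟩ := hint' g (by simp [hTeq]) g' (by simp [hTeq])
    obtain ⟨w, rfl⟩ := hug
    obtain ⟨w', rfl⟩ := hug'
    -- The two edges cover at most 3 of the 6 neighbours. On the `s ≥ 3` others the pair count would
    -- give `2 * s ≤ s + 2`.
    have h3 : #{u, w, w'} ≤ 3 := card_le_three
    have h4 := le_card_sdiff {u, w, w'} N
    have h5 := (mul_le_card_star_pairs (N \ {u, w, w'}) T #(N \ {u, w, w'}) fun g hg => by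
        rw [filter_true_of_mem]
        intro x hx hxg
        rw [mem_sdiff] at hx
        rw [hTeq, mem_insert, mem_singleton] at hg
        refine hx.2 ?_
        rcases hg with rfl | rfl <;> rcases Sym2.mem_iff.1 hxg with rfl | rfl <;> simp).trans
      (card_star_pairs_le f v _ T fun x hx => hpair x (mem_sdiff.1 hx).1)
    have h6 : #{g ∈ T | ∃ x ∈ N \ {u, w, w'}, f g = s(v, x)} ≤ #T := card_filter_le _ _
    rw [hk2] at h5 h6
    omega

end TwoEdges

/-! ### Constructions for `n = 4, 5, 6` -/

section SmallCases

theorem mem_hSet_two_of_finset (n m : ℕ) (E : Finset (Sym2 (Fin n)))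
    (f : Sym2 (Fin n) → Sym2 (Fin n)) (hm : #E = m)
    (hE : ∀ e ∈ E, ¬ e.IsDiag) (hf : ∀ e ∈ E, f e ∈ E ∧ f e ≠ e)
    (hd : ∀ e ∈ E, ∀ e' ∈ E, (∃ v ∈ e, v ∈ e') ∨ f e = e' ∨ f e' = e) :
    m ∈ hSet n (matching 2) := by
  have hH : (SimpleGraph.fromEdgeSet (E : Set (Sym2 (Fin n)))).edgeSet = E := by
    ext e
    rw [SimpleGraph.edgeSet_fromEdgeSet, Set.mem_sdiff, Sym2.mem_diagSet]
    exact and_iff_left_of_imp fun h => hE e h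
  refine ⟨SimpleGraph.fromEdgeSet E, ?_, avoids_two_of_map f ?_ ?_⟩
  · rw [hH, Set.ncard_coe_finset, hm]
  · simpa only [hH, mem_coe] using hf
  · simpa only [hH, mem_coe] using hd

/-- In `K₄` each edge is disjoint only from its opposite, so swapping opposite edges works. -/
theorem six_mem_hSet_four : 6 ∈ hSet 4 (matching 2) :=
  mem_hSet_two_of_finset 4 6 {s(0, 1), s(0, 2), s(0, 3), s(1, 2), s(1, 3), s(2, 3)}
    (fun e => if e = s(0, 1) then s(2, 3) else if e = s(0, 2) then s(1, 3) else
      if e = s(0, 3) then s(1, 2) else if e = s(1, 2) then s(0, 3) else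
      if e = s(1, 3) then s(0, 2) else s(0, 1))
    (by decide) (by decide) (by decide) (by decide)

/-- The edges of `K₄` with a pendant edge at the vertex `0`. -/
def pendantEdges (n : ℕ) [NeZero n] : Finset (Sym2 (Fin n)) :=
  {s(0, 1), s(0, 2), s(0, 3), s(1, 2), s(1, 3), s(2, 3), s(0, 4)}

/-- The map that sends the edges of `K₄` at the vertex `0` to the opposite edges, and those to the
pendant edge. -/
def pendantMap (n : ℕ) [NeZero n] (e : Sym2 (Fin n)) : Sym2 (Fin n) :=
  if e = s(0, 1) then s(2, 3) else if e = s(0, 2) then s(1, 3) else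
    if e = s(0, 3) then s(1, 2) else if e = s(0, 4) then s(0, 1) else s(0, 4)

theorem seven_mem_hSet_five : 7 ∈ hSet 5 (matching 2) :=
  mem_hSet_two_of_finset 5 7 (pendantEdges 5) (pendantMap 5)
    (by decide) (by decide) (by decide) (by decide)

theorem seven_mem_hSet_six : 7 ∈ hSet 6 (matching 2) :=
  mem_hSet_two_of_finset 6 7 (pendantEdges 6) (pendantMap 6)
    (by decide) (by decide) (by decide) (by decide)

end SmallCases

/-! ### Exact values from matching bounds -/

theorem h_eq_of_mem_of_le {W : Type*} {n m : ℕ} {G : SimpleGraph W} (hm : m ∈ hSet n G)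
    (hle : ∀ k ∈ hSet n G, k ≤ m) : h n G = m :=
  IsGreatest.csSup_eq ⟨hm, hle⟩

theorem le_max_of_mem_hSet_two {n k : ℕ} (hn : 0 < n) (hk : k ∈ hSet n (matching 2)) :
    k ≤ max n 7 := by
  classical
  obtain ⟨H, rfl, hH⟩ := hk
  have : Nonempty (Fin n) := ⟨⟨0, hn⟩⟩
  have h1 := card_edgeFinset_le_of_avoids_two hH
  rwa [Fintype.card_fin, ← SimpleGraph.coe_edgeFinset, Set.ncard_coe_finset] at *

theorem le_choose_two_of_mem_hSet {W : Type*} {n k : ℕ} {G : SimpleGraph W} (hk : k ∈ hSet n G) :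
    k ≤ n.choose 2 := by
  classical
  obtain ⟨H, rfl, -⟩ := hk
  have h1 := H.card_edgeFinset_le_card_choose_two
  rwa [Fintype.card_fin, ← Set.ncard_coe_finset, SimpleGraph.coe_edgeFinset] at h1

theorem h_matching_two {n : ℕ} (hn : 7 ≤ n) : h n (matching 2) = n := by
  refine h_eq_of_mem_of_le ?_ fun k hk => ?_
  · have h1 := mem_hSet_matching n 2 le_rfl (by omega)
    have h2 : (2 - 1) * (n - 2 + 1) + (2 - 1).choose 2 + (2 - 1) = n := by
      simp; omega
    rwa [h2] at h1
  · have := le_max_of_mem_hSet_two (by omega) hk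
    omega

theorem h_matching {n t : ℕ} (ht : 2 ≤ t) (hn : threshold t ≤ n) :
    h n (matching t) = (t - 1) * (n - t + 1) + (t - 1).choose 2 + (t - 1) := by
  classical
  have hn' : 2 * t ≤ n := le_trans (by unfold threshold; omega) hn
  refine h_eq_of_mem_of_le (mem_hSet_matching n t ht (by omega)) ?_
  rintro _ ⟨H, rfl, hH⟩
  have h1 := card_edgeFinset_le_of_avoids t (by omega) (by simpa using hn) hH
  rwa [Fintype.card_fin, ← Set.ncard_coe_finset, SimpleGraph.coe_edgeFinset] at h1

theorem extremalNumber_matching {n t : ℕ} (ht : 1 ≤ t) (hn : threshold t ≤ n) :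
    SimpleGraph.extremalNumber n (matching t) = (t - 1) * (n - t + 1) + (t - 1).choose 2 := by
  classical
  have hn' : 2 * t ≤ n := le_trans (by unfold threshold; omega) hn
  refine le_antisymm ?_ (le_extremalNumber n t ht (by omega))
  conv_lhs => rw [← Fintype.card_fin n]
  rw [SimpleGraph.extremalNumber_le_iff]
  intro H _ hH
  have h1 := card_edgeFinset_le_of_free t ht (by simpa using hn) hH
  rwa [Fintype.card_fin] at h1

end EdgeMapping

theorem mainTheorem1 :
    ((∀ n : ℕ, 7 ≤ n → EdgeMapping.h n (EdgeMapping.matching 2) = n) ∧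
      EdgeMapping.h 4 (EdgeMapping.matching 2) = 6 ∧
      EdgeMapping.h 5 (EdgeMapping.matching 2) = 7 ∧
      EdgeMapping.h 6 (EdgeMapping.matching 2) = 7) ∧
    (∀ t : ℕ, 3 ≤ t → ∃ n_t : ℕ, t ≤ n_t ∧ ∀ n : ℕ, n_t ≤ n →
      EdgeMapping.h n (EdgeMapping.matching t) =
        SimpleGraph.extremalNumber n (EdgeMapping.matching t) + (t - 1) ∧
      SimpleGraph.extremalNumber n (EdgeMapping.matching t) + (t - 1) =
        (t - 1) * (n - t + 1) + (t - 1).choose 2 + (t - 1)) := by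
  open EdgeMapping in
  refine ⟨⟨fun n hn => h_matching_two hn, ?_, ?_, ?_⟩, fun t ht => ?_⟩
  · exact h_eq_of_mem_of_le six_mem_hSet_four fun k hk => le_choose_two_of_mem_hSet hk
  · exact h_eq_of_mem_of_le seven_mem_hSet_five fun k hk =>
      le_max_of_mem_hSet_two (by omega) hk
  · exact h_eq_of_mem_of_le seven_mem_hSet_six fun k hk =>
      le_max_of_mem_hSet_two (by omega) hk
  · refine ⟨threshold t, by unfold threshold; omega, fun n hn => ?_⟩
    rw [h_matching (by omega) hn, extremalNumber_matching (by omega) hn]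
    exact ⟨rfl, rfl⟩
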